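/- Fix integers $d,k,T,c_{\max}\ge 0$ and put $N=k\cdot c_{\max}$. A stream is $x=(x^1,\dots,x^T)$ with $x^t\in\{0,1\}^d$; two streams are neighboring if they differ in at most one time step. A randomized algorithm $\mathcal A$ on streams is $\epsilon$-differentially private if $\Pr[\mathcal A(x)\in S]\le e^{\epsilon}\Pr[\mathcal A(y)\in S]$ for all neighboring $x,y$ and all measurable sets $S$ of outputs. $\mathrm{Lap}(b)$ is the distribution on $\mathbb R$ with density $\frac1{2b}e^{-|z|/b}$. **Queries.** A monotone histogram query with sensitivity 1 is a measurable function $g:\mathbb R^d\to\mathbb R$ (evaluated at exact and at noisy histograms) with $g(0)=0$, $g(h)\le g(h+u)$ for $h\in\mathbb N^d$, $u\in\{0,1\}^d$, and $|g(v)-g(w)|\le 1$ whenever $\|v-w\|_\infty\le 1$. **Histogram mechanisms and adaptive privacy.** A continuous histogram mechanism $H$ is a randomized mechanism that receives vectors $c^1,c^2,\dots\in\mathbb N^d$ one at a time and after each $c^j$ outputs a vector in $\mathbb R^d$ depending only on $c^1,\dots,c^j$ and on its random coins. In the privacy game of length $N$ with side $L$ or $R$, a randomized adversary, whose coins are independent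 of those of $H$ and who does not know the side, chooses in each round $j\in\{1,\dots,N\}$, depending on its own coins and on the answers of $H$ so far, either one vector in $\mathbb N^d$ (a regular round), which is sent to $H$, or a pair $(c_L,c_R)$ of vectors in $\mathbb N^d$ with $\|c_L-c_R\|_\infty\le 1$ (a challenge round), of which $c_{\text{side}}$ is sent to $H$; in every play exactly one round is a challenge. The view $V^{(\text{side})}$ consists of the adversary's coins, its moves, and all answers of $H$. $H$ is adaptively $\epsilon'$-differentially private for streams of length $N$ if $\Pr[V^{(L)}\in S]\le e^{\epsilon'}\Pr[V^{(R)}\in S]$ and $\Pr[V^{(R)}\in S]\le e^{\epsilon'}\Pr[V^{(L)}\in S]$ for every such adversary and every measurable set $S$ of views. **The $k$-query mechanism** with queries $g_1,\dots,g_k$, histogram mechanism $H$ and parameters $s^0\in\mathbb R^d$, $K,C\in\mathbb R$. All Laplace variables are drawn freshly, independently of each other and of $H$. Initialize $j\leftarrow 1$, $c\leftarrow 0\in\mathbb N^d$, $s\leftarrow s^0$, draw $\tau\sim\mathrm{Lap}(6/\epsilon)$, set $K_{(i)}\leftarrow K$ and $\tilde K_{(i)}\leftarrow K_{(i)}+\tau$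 for all $i\in[k]$, and $\mathrm{out}\leftarrow(g_1(0),\dots,g_k(0))$. At each time $t=1,\dots,T$: 1. $c\leftarrow c+x^t$, $s\leftarrow s+x^t$, and draw $\mu\sim\mathrm{Lap}(12/\epsilon)$. 2. If $g_i(s)+\mu>\tilde K_{(i)}$ for some $i\in[k]$, and $j\le N$, then: set $j\leftarrow j+1$; insert $c$ into $H$ and reset $c\leftarrow 0$; for each $i\in[k]$ draw independent $\gamma_i\sim\mathrm{Lap}(3k/\epsilon)$ and, if $g_i(s)+\gamma_i>K_{(i)}-C$, set $K_{(i)}\leftarrow K_{(i)}+K$; draw a new $\tau\sim\mathrm{Lap}(6/\epsilon)$ and set $\tilde K_{(i)}\leftarrow K_{(i)}+\tau$ for all $i$; let $s$ be the current output of $H$ and set $\mathrm{out}\leftarrow(g_1(s),\dots,g_k(s))$. 3. Output $\mathrm{out}$. **Lemma.** Let $\epsilon>0$, let $g_1,\dots,g_k$ be monotone histogram queries with sensitivity 1, and let $H$ be a continuous histogram mechanism that is adaptively $(\epsilon/3)$-differentially private for streams of length $N=k\cdot c_{\max}$. Then the $k$-query mechanism with $s^0=0$, $C=18\epsilon^{-1}\left(k\ln(6k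 c_{\max}/\beta)+\ln(6T/\beta)\right)$ and $K=3\left(C+\mathrm{err}(k c_{\max})\right)$ is $\epsilon$-differentially private, for every $\beta\in(0,1)$ and every real-valued error bound function $\mathrm{err}$. (Where an argument of $\ln$ is $0$, read $\ln 0=0$.) Moreover, this holds independently of the initial setting of $s$, $K$ and $C$: the mechanism is $\epsilon$-differentially private for all $s^0\in\mathbb R^d$ and all $K,C\in\mathbb R$. -/

import Mathlib

open MeasureTheory

noncomputable section

/-! ### Streams, differential privacy, Laplace noise -/

/-- A stream `x¹, …, x^T` of elements of `{0,1}^d`. -/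
abbrev BinStream (d T : ℕ) : Type := Fin T → Fin d → Fin 2

/-- Two streams are neighboring if they differ in at most one time step. -/
def Neighboring {d T : ℕ} (x y : BinStream d T) : Prop :=
  ∀ t t' : Fin T, x t ≠ y t → x t' ≠ y t' → t = t'

/-- `ε`-differential privacy of a randomized algorithm `A` on streams. The algorithm is presented
by a probability space `(Ω, P)` of coin flips; `A x ω` is its whole output on input `x` when the
coins come up as `ω`. -/
def IsDifferentiallyPrivate {d T : ℕ} {Ω O : Type*} [MeasurableSpace Ω] [MeasurableSpace O]
    (P : Measure Ω) (A : BinStream d T → Ω → O) (ε : ℝ) : Prop :=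
  ∀ x y : BinStream d T, Neighboring x y → ∀ S : Set O, MeasurableSet S →
    P {ω | A x ω ∈ S} ≤ ENNReal.ofReal (Real.exp ε) * P {ω | A y ω ∈ S}

/-- The Laplace distribution centered at `0` with scale `b` (used for `b > 0`). -/
def laplaceMeasure (b : ℝ) : Measure ℝ :=
  volume.withDensity fun z => ENNReal.ofReal (1 / (2 * b) * Real.exp (-|z| / b))

/-! ### Queries -/

/-- Monotone histogram queries with sensitivity `1`. The mechanism evaluates queries also at noisy
(real) histograms, so a query is a (measurable) function on all of `ℝ^d`. The norm on
`Fin d → ℝ` is the sup norm. -/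
structure IsMonotoneHistogramQuery {d : ℕ} (g : (Fin d → ℝ) → ℝ) : Prop where
  measurable : Measurable g
  /-- Appending one more element `u ∈ {0,1}^d` to a stream with histogram `h` does not decrease
  the query value. -/
  monotone : ∀ (h : Fin d → ℕ) (u : Fin d → Fin 2),
    g (fun i => (h i : ℝ)) ≤ g (fun i => (h i : ℝ) + ((u i : ℕ) : ℝ))
  sensitivity : ∀ v w : Fin d → ℝ, ‖v - w‖ ≤ 1 → |g v - g w| ≤ 1
  map_zero : g 0 = 0

/-! ### Continuous histogram mechanisms and the adaptive continual release model -/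

universe u

/-- A (randomized, interactive) continuous histogram mechanism: it has a probability space of
random coins, and after having received the inputs `x₁, …, x_t ∈ ℕ^d` it outputs the vector
`respond ω [x₁, …, x_t] ∈ ℝ^d`, which depends only on these inputs and on its coins `ω`. -/
structure HistogramMechanism (d : ℕ) : Type (u + 1) where
  Coins : Type u
  [measurableSpace : MeasurableSpace Coins]
  P : Measure Coins
  [isProbabilityMeasure : IsProbabilityMeasure P]
  respond : Coins → List (Fin d → ℕ) → (Fin d → ℝ)
  measurable_respond : ∀ l : List (Fin d → ℕ), Measurable fun ω => respond ω l

attribute [instance] HistogramMechanism.measurableSpace HistogramMechanism.isProbabilityMeasure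

/-- What the adversary sends in one time step of the privacy game. -/
inductive AdvMove (d : ℕ) : Type where
  | regular (x : Fin d → ℕ)
  | challenge (xL xR : Fin d → ℕ)

instance (d : ℕ) : MeasurableSpace (AdvMove d) := ⊤

/-- The side chosen by the oracle before the game starts. -/
inductive Side : Type where
  | L
  | R

/-- The move is a challenge. -/
def AdvMove.IsChallenge {d : ℕ} : AdvMove d → Prop
  | .regular _ => False
  | .challenge _ _ => True

/-- A challenge consists of two vectors at sup distance at most `1`. -/
def AdvMove.IsAdmissible {d : ℕ} : AdvMove d → Prop
  | .regular _ => True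
  | .challenge xL xR => ∀ i, |(xL i : ℤ) - (xR i : ℤ)| ≤ 1

/-- The input which the oracle forwards to the mechanism. -/
def AdvMove.forward {d : ℕ} : AdvMove d → Side → (Fin d → ℕ)
  | .regular x, _ => x
  | .challenge xL _, .L => xL
  | .challenge _ xR, .R => xR

/-- A randomized adversary for the game of length `N`. After `n` rounds it knows its own coins and
the `n` answers of the mechanism so far, and chooses its next move as a function of these. In
every play, exactly one of the `N` rounds is a challenge. -/
structure Adversary (d N : ℕ) : Type 1 where
  Coins : Type
  [measurableSpace : MeasurableSpace Coins]
  P : Measure Coins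
  [isProbabilityMeasure : IsProbabilityMeasure P]
  move : (n : ℕ) → Coins × (Fin n → Fin d → ℝ) → AdvMove d
  measurable_move : ∀ n, Measurable (move n)
  admissible : ∀ n p, (move n p).IsAdmissible
  existsUnique_challenge : ∀ (α : Coins) (a : Fin N → Fin d → ℝ),
    ∃! t : Fin N, (move t (α, fun i => a (i.castLE t.isLt.le))).IsChallenge

attribute [instance] Adversary.measurableSpace Adversary.isProbabilityMeasure

/-- The first `n` rounds of the privacy game, with the coins of both parties fixed: the list of
inputs that the mechanism has received, and the tuple of answers that it has given. -/
def gamePlay {d N : ℕ} (H : HistogramMechanism.{u} d) (A : Adversary d N) (side : Side)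
    (α : A.Coins) (ω : H.Coins) :
    (n : ℕ) → List (Fin d → ℕ) × (Fin n → Fin d → ℝ)
  | 0 => ([], Fin.elim0)
  | n + 1 =>
    let p := gamePlay H A side α ω n
    let l := p.1 ++ [(A.move n (α, p.2)).forward side]
    (l, Fin.snoc p.2 (H.respond ω l))

/-- The view of the adversary at the end of the game: its coins, its moves, and the answers of
the mechanism. -/
def gameView {d N : ℕ} (H : HistogramMechanism.{u} d) (A : Adversary d N) (side : Side)
    (p : A.Coins × H.Coins) : A.Coins × (Fin N → AdvMove d) × (Fin N → Fin d → ℝ) :=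
  let a : Fin N → Fin d → ℝ := (gamePlay H A side p.1 p.2 N).2
  (p.1, (fun t => A.move t (p.1, fun i => a (i.castLE t.isLt.le))), a)

/-- `ε`-differential privacy in the adaptive continual release model, for the mechanism `H` run on
streams of length `N`. The coins of `H` and of the adversary are independent. -/
def HistogramMechanism.IsAdaptivelyDP {d : ℕ} (H : HistogramMechanism.{u} d) (N : ℕ) (ε : ℝ) :
    Prop :=
  ∀ (A : Adversary d N) (S : Set (A.Coins × (Fin N → AdvMove d) × (Fin N → Fin d → ℝ))),
    MeasurableSet S →
      (A.P.prod H.P) {p | gameView H A .L p ∈ S} ≤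
          ENNReal.ofReal (Real.exp ε) * (A.P.prod H.P) {p | gameView H A .R p ∈ S} ∧
      (A.P.prod H.P) {p | gameView H A .R p ∈ S} ≤
          ENNReal.ofReal (Real.exp ε) * (A.P.prod H.P) {p | gameView H A .L p ∈ S}

/-! ### The mechanism for answering `k` queries -/

/-- The Laplace noises drawn by the mechanism on a stream of length `T`, with at most `N`
intervals closed: `tau m` is the noise shared by all `k` thresholds while exactly `m` intervals
have been closed, `mu t` is the noise shared by all `k` query values at time `t`, and
`gamma m i` is the noise added to the `i`-th query value for the threshold update when the
interval number `m` (counted from `0`) is closed. -/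
abbrev Noise (T N k : ℕ) : Type :=
  (Fin (N + 1) → ℝ) × (Fin T → ℝ) × (Fin N → Fin k → ℝ)

/-- All noises are independent, with `tau m ∼ Lap(6/ε)`, `mu t ∼ Lap(12/ε)` and
`gamma m i ∼ Lap(3k/ε)`. -/
def noiseMeasure (T N k : ℕ) (ε : ℝ) : Measure (Noise T N k) :=
  (Measure.pi fun _ => laplaceMeasure (6 / ε)).prod
    ((Measure.pi fun _ => laplaceMeasure (12 / ε)).prod
      (Measure.pi fun _ => Measure.pi fun _ => laplaceMeasure (3 * k / ε)))

/-- The variables of the mechanism. -/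
structure MechState (d k : ℕ) where
  /-- Number of intervals closed so far (the counter `j` of the pseudocode is `closed + 1`). -/
  closed : ℕ
  /-- The exact counts `c` within the current interval. -/
  count : Fin d → ℕ
  /-- The current noisy histogram `s`. -/
  hist : Fin d → ℝ
  /-- The thresholds `K₍ᵢ₎`. -/
  thresh : Fin k → ℝ
  /-- The noisy thresholds. -/
  noisyThresh : Fin k → ℝ
  /-- The inputs inserted into `H` so far. -/
  inserted : List (Fin d → ℕ)
  /-- The current output. -/
  out : Fin k → ℝ

/-- The state before the first time step. -/
def initState {d k T N : ℕ} (g : Fin k → (Fin d → ℝ) → ℝ) (s₀ : Fin d → ℝ) (K : ℝ)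
    (ν : Noise T N k) : MechState d k where
  closed := 0
  count := 0
  hist := s₀
  thresh := fun _ => K
  noisyThresh := fun _ => K + ν.1 0
  inserted := []
  out := fun i => g i 0

open Classical in
/-- The body of the main loop, executed at time `t` with input `xt`. -/
def stepState {d k T N : ℕ} (g : Fin k → (Fin d → ℝ) → ℝ) (H : HistogramMechanism.{u} d)
    (K C : ℝ) (ν : Noise T N k) (ω : H.Coins) (t : Fin T) (xt : Fin d → Fin 2)
    (σ : MechState d k) : MechState d k :=
  let c : Fin d → ℕ := fun i => σ.count i + (xt i : ℕ)
  let s : Fin d → ℝ := fun i => σ.hist i + ((xt i : ℕ) : ℝ)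
  if h : (∃ i, g i s + ν.2.1 t > σ.noisyThresh i) ∧ σ.closed < N then
    let thr : Fin k → ℝ := fun i =>
      if g i s + ν.2.2 ⟨σ.closed, h.2⟩ i > σ.thresh i - C then σ.thresh i + K else σ.thresh i
    let l := σ.inserted ++ [c]
    let s' := H.respond ω l
    { closed := σ.closed + 1
      count := 0
      hist := s'
      thresh := thr
      noisyThresh := fun i => thr i + ν.1 ⟨σ.closed + 1, Nat.succ_lt_succ h.2⟩
      inserted := l
      out := fun i => g i s' }
  else { σ with count := c, hist := s }

/-- The state after the first `n` time steps. -/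
def stateAfter {d k T N : ℕ} (g : Fin k → (Fin d → ℝ) → ℝ) (H : HistogramMechanism.{u} d)
    (s₀ : Fin d → ℝ) (K C : ℝ) (x : BinStream d T) (ν : Noise T N k) (ω : H.Coins) :
    ℕ → MechState d k
  | 0 => initState g s₀ K ν
  | n + 1 =>
    if h : n < T then
      stepState g H K C ν ω ⟨n, h⟩ (x ⟨n, h⟩) (stateAfter g H s₀ K C x ν ω n)
    else stateAfter g H s₀ K C x ν ω n

/-- The `k`-query partitioning mechanism with initial noisy histogram `s₀`, threshold parameter
`K`, slack `C`, and at most `N` closed intervals: the outputs at all time steps `t ∈ [T]`. -/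
def kQueryMechanism {d k T : ℕ} (N : ℕ) (g : Fin k → (Fin d → ℝ) → ℝ)
    (H : HistogramMechanism.{u} d) (s₀ : Fin d → ℝ) (K C : ℝ) (x : BinStream d T)
    (p : Noise T N k × H.Coins) : Fin T → Fin k → ℝ :=
  fun t => (stateAfter g H s₀ K C x p.1 p.2 (t + 1)).out

/-- The parameter `C = 18 ε⁻¹ (k ln(6 k c_max / β) + ln(6 T / β))` of the mechanism. -/
def slackParam (k T cmax : ℕ) (ε β : ℝ) : ℝ :=
  18 * ε⁻¹ * (k * Real.log (6 * k * cmax / β) + Real.log (6 * T / β))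

/-- The parameter `K = 3 (C + err(k c_max))` of the mechanism. -/
def threshParam (k T cmax : ℕ) (ε β : ℝ) (err : ℕ → ℝ) : ℝ :=
  3 * (slackParam k T cmax ε β + err (k * cmax))

end

/-!
The mechanism is compared with a hybrid machine that reads two streams: the first drives the noisy
histogram, and with it all decisions (when an interval is closed and which thresholds are raised),
the second drives the exact counts that are inserted into the histogram mechanism `H`. On equal
streams it is the mechanism itself (`kQueryMechanism_eq_run`). Let `x` and `y` differ only at time
`ts`. Passing from `(x, x)` to `(x, y)` costs `ε / 3`, and passing from `(x, y)` to `(y, y)` costs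
`2 ε / 3`.

*The insertions* (`MechParams.prod_output_mem_le`). An adversary whose coins are the noises of the
mechanism simulates the decisions on `x`, taking the answers in the privacy game for the outputs of
`H`. In every round it sends the sum of the stream over the corresponding interval; these sums agree
for `x` and `y` except in the interval that contains `ts`, where they are made a challenge. The move
in a round depends on the preceding answers only (`MechParams.nextMove_trace_congr`). The game with
side `L` is the machine on `(x, x)`, the game with side `R` is the machine on `(x, y)`, and the
output is the same function of the view (`MechParams.output_respond_eq`), so that the adaptive
privacy of `H` applies.

*The decisions* (`MechParams.noiseMeasure_output_mem_le`). Fix the coins of `H` and the sequence `η`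
of all decisions. Then the states of the machine are constants, the output is the same for `(x, y)`
and `(y, y)`, and the noises only have to decide for `η` in these states. The noisy histograms differ
by at most `1` between time `ts` and the next closing, and nowhere else. Hence if the noises lead to
`η` on `(x, y)`, then they do so on `(y, y)` after a translation by a constant vector
(`MechParams.event_shiftNoise`): the threshold noise of that interval grows by `1`, the query noise
at its closing by `2`, and each update noise at the closing by at most `1`. For Laplace noise the
translation costs `ε / 6 + 2 ε / 12 + k ε / (3 k) = 2 ε / 3` (`noiseMeasure_map_shiftNoise_le`). It
remains to sum over the finitely many `η` and to integrate over the coins of `H`.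
-/

/-! ### Laplace noise and its translates -/

theorem isProbabilityMeasure_laplaceMeasure {b : ℝ} (hb : 0 < b) :
    IsProbabilityMeasure (laplaceMeasure b) := by
  have hint : ∫ z : ℝ, 1 / (2 * b) * Real.exp (-|z| / b) = 1 := by
    rw [integral_const_mul, integral_comp_abs (f := fun z => Real.exp (-z / b))]
    have h := integral_exp_mul_Ioi (a := -b⁻¹) (by simpa using hb) 0
    have h' : ∀ z : ℝ, -z / b = -b⁻¹ * z := fun z => by ring
    simp only [h', h]
    simp
    field_simp
  -- a function with nonzero Bochner integral is integrable
  have hI : Integrable fun z : ℝ => 1 / (2 * b) * Real.exp (-|z| / b) := by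
    by_contra h
    rw [integral_undef h] at hint
    exact zero_ne_one hint
  refine ⟨?_⟩
  rw [laplaceMeasure, withDensity_apply _ MeasurableSet.univ, Measure.restrict_univ,
    ← ofReal_integral_eq_lintegral_ofReal hI (ae_of_all _ fun z => by positivity), hint,
    ENNReal.ofReal_one]

instance isFiniteMeasure_laplaceMeasure (b : ℝ) : IsFiniteMeasure (laplaceMeasure b) := by
  rcases lt_or_ge 0 b with hb | hb
  · have := isProbabilityMeasure_laplaceMeasure hb
    infer_instance
  · -- for `b ≤ 0` the density is nonpositive, so that the measure vanishes
    have h : (fun z : ℝ => ENNReal.ofReal (1 / (2 * b) * Real.exp (-|z| / b))) = 0 := by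
      funext z
      refine ENNReal.ofReal_of_nonpos (mul_nonpos_of_nonpos_of_nonneg ?_ (Real.exp_pos _).le)
      exact div_nonpos_of_nonneg_of_nonpos zero_le_one (by linarith)
    rw [laplaceMeasure, h, withDensity_zero]
    infer_instance

/-- Translating Laplace noise of scale `b` by `a` costs privacy `|a| / b`. -/
theorem laplaceMeasure_map_add_le {b : ℝ} (hb : 0 < b) (a : ℝ) :
    (laplaceMeasure b).map (fun z => z + a) ≤
      ENNReal.ofReal (Real.exp (|a| / b)) • laplaceMeasure b := by
  refine Measure.le_iff.2 fun s hs => ?_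
  have hm : Measurable fun z : ℝ => z + a := measurable_id.add_const a
  rw [Measure.map_apply hm hs, Measure.smul_apply, smul_eq_mul, laplaceMeasure,
    withDensity_apply _ (hm hs), withDensity_apply _ hs,
    ← lintegral_indicator (hm hs), ← lintegral_indicator hs]
  have h1 : ∀ z, ((fun z : ℝ => z + a) ⁻¹' s).indicator
      (fun z => ENNReal.ofReal (1 / (2 * b) * Real.exp (-|z| / b))) z =
      s.indicator (fun w => ENNReal.ofReal (1 / (2 * b) * Real.exp (-|w - a| / b))) (z + a) := by
    intro z
    by_cases hz : z + a ∈ s <;> simp [hz]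
  simp only [h1]
  rw [lintegral_add_right_eq_self
    (fun w => s.indicator (fun w => ENNReal.ofReal (1 / (2 * b) * Real.exp (-|w - a| / b))) w) a,
    ← lintegral_const_mul' _ _ ENNReal.ofReal_ne_top]
  refine lintegral_mono fun w => ?_
  by_cases hw : w ∈ s
  · simp only [Set.indicator_of_mem hw]
    rw [← ENNReal.ofReal_mul (Real.exp_pos _).le]
    refine ENNReal.ofReal_le_ofReal ?_
    rw [mul_left_comm, ← Real.exp_add, ← add_div]
    refine mul_le_mul_of_nonneg_left (Real.exp_le_exp.2 ?_) (by positivity)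
    have := abs_sub_abs_le_abs_sub w a
    have := abs_sub_abs_le_abs_sub w (w - a)
    gcongr
    simp only [sub_sub_cancel] at this
    linarith
  · simp [hw]

/-- Privacy costs of independent noises add up. -/
theorem pi_map_le_of_map_le {ι X : Type*} [Fintype ι] [MeasurableSpace X] (μ : ι → Measure X)
    [∀ i, IsFiniteMeasure (μ i)] (f : ι → X → X) (hf : ∀ i, Measurable (f i)) (e : ι → ℝ)
    (h : ∀ i, (μ i).map (f i) ≤ ENNReal.ofReal (Real.exp (e i)) • μ i) :
    (Measure.pi μ).map (fun z i => f i (z i)) ≤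
      ENNReal.ofReal (Real.exp (∑ i, e i)) • Measure.pi μ := by
  have hfin : ∀ i, IsFiniteMeasure (ENNReal.ofReal (Real.exp (e i)) • μ i) := fun i =>
    Measure.smul_finite _ ENNReal.ofReal_ne_top
  rw [Measure.pi_map_pi fun i => (hf i).aemeasurable]
  have hsmul : ENNReal.ofReal (Real.exp (∑ i, e i)) • Measure.pi μ =
      Measure.pi fun i => ENNReal.ofReal (Real.exp (e i)) • μ i := by
    refine (Measure.pi_eq fun s _ => ?_).symm
    simp only [Measure.smul_apply, smul_eq_mul, Measure.pi_pi, Finset.prod_mul_distrib]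
    rw [Real.exp_sum, ENNReal.ofReal_prod_of_nonneg fun i _ => (Real.exp_pos _).le]
  rw [hsmul]
  refine Measure.le_iff.2 fun s hs => ?_
  conv_rhs => rw [Measure.pi_def, toMeasure_apply _ _ hs]
  have hle : (Measure.pi fun i => (μ i).map (f i)).toOuterMeasure ≤
      OuterMeasure.pi fun i => (ENNReal.ofReal (Real.exp (e i)) • μ i).toOuterMeasure := by
    refine OuterMeasure.le_pi.2 fun t _ => ?_
    change (Measure.pi fun i => (μ i).map (f i)) (Set.univ.pi t) ≤ _
    rw [Measure.pi_pi]
    exact Finset.prod_le_prod' fun i _ => h i (t i)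
  exact hle s

theorem prod_map_le_of_map_le {X Y : Type*} [MeasurableSpace X] [MeasurableSpace Y]
    {μ : Measure X} {ν : Measure Y} [IsFiniteMeasure μ] [IsFiniteMeasure ν] {f : X → X}
    {f' : Y → Y} (hf : Measurable f) (hf' : Measurable f') {e e' : ℝ}
    (h : μ.map f ≤ ENNReal.ofReal (Real.exp e) • μ)
    (h' : ν.map f' ≤ ENNReal.ofReal (Real.exp e') • ν) :
    (μ.prod ν).map (Prod.map f f') ≤ ENNReal.ofReal (Real.exp (e + e')) • μ.prod ν := by
  have hfin := Measure.smul_finite ν (c := ENNReal.ofReal (Real.exp e')) ENNReal.ofReal_ne_top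
  rw [← Measure.map_prod_map _ _ hf hf', Real.exp_add, ENNReal.ofReal_mul (Real.exp_pos _).le]
  refine (Measure.prod_mono h h').trans_eq ?_
  rw [Measure.prod_smul_left, Measure.prod_smul_right, smul_smul]

theorem pi_laplaceMeasure_map_add_le {ι : Type*} [Fintype ι] {b : ℝ} (hb : 0 < b) (a : ι → ℝ) :
    (Measure.pi fun _ : ι => laplaceMeasure b).map (fun z i => z i + a i) ≤
      ENNReal.ofReal (Real.exp (∑ i, |a i| / b)) • Measure.pi fun _ : ι => laplaceMeasure b :=
  pi_map_le_of_map_le _ (fun i z => z + a i) (fun _ => measurable_id.add_const _) _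
    fun i => laplaceMeasure_map_add_le hb (a i)

theorem isProbabilityMeasure_pi_laplaceMeasure {ι : Type*} [Fintype ι] {b : ℝ}
    (hb : Nonempty ι → 0 < b) :
    IsProbabilityMeasure (Measure.pi fun _ : ι => laplaceMeasure b) := by
  refine ⟨?_⟩
  rw [Measure.pi_univ]
  exact Finset.prod_eq_one fun i _ =>
    (isProbabilityMeasure_laplaceMeasure (hb ⟨i⟩)).measure_univ

theorem isProbabilityMeasure_noiseMeasure (T N k : ℕ) {ε : ℝ} (hε : 0 < ε) :
    IsProbabilityMeasure (noiseMeasure T N k ε) := by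
  have hk : Nonempty (Fin k) → 0 < 3 * (k : ℝ) / ε := fun ⟨i⟩ => by
    have : (0 : ℝ) < k := Nat.cast_pos.2 i.pos
    positivity
  have h1 := isProbabilityMeasure_pi_laplaceMeasure (ι := Fin (N + 1)) (b := 6 / ε)
    fun _ => by positivity
  have h2 := isProbabilityMeasure_pi_laplaceMeasure (ι := Fin T) (b := 12 / ε)
    fun _ => by positivity
  have h3 := isProbabilityMeasure_pi_laplaceMeasure (ι := Fin k) hk
  unfold noiseMeasure
  infer_instance

/-- Translation of the noises by `a`. -/
def shiftNoise {T N k : ℕ} (a ν : Noise T N k) : Noise T N k :=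
  Prod.map (fun z i => z i + a.1 i)
    (Prod.map (fun z i => z i + a.2.1 i) (fun z j i => z j i + a.2.2 j i)) ν

theorem measurable_shiftNoise {T N k : ℕ} (a : Noise T N k) : Measurable (shiftNoise a) := by
  unfold shiftNoise
  fun_prop

/-- A translation of the noises which moves the threshold noises by at most `1` in total, the query
noises by at most `2` in total, and each of the `k` update noises of at most one interval by at
most `1`, costs privacy `2 ε / 3`. -/
theorem noiseMeasure_map_shiftNoise_le {T N k : ℕ} {ε : ℝ} (hε : 0 < ε) (a : Noise T N k)
    (h₁ : ∑ j, |a.1 j| ≤ 1) (h₂ : ∑ t, |a.2.1 t| ≤ 2) (h₃ : ∀ i, ∑ j, |a.2.2 j i| ≤ 1) :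
    (noiseMeasure T N k ε).map (shiftNoise a) ≤
      ENNReal.ofReal (Real.exp (2 * ε / 3)) • noiseMeasure T N k ε := by
  have hτ := pi_laplaceMeasure_map_add_le (b := 6 / ε) (by positivity) a.1
  have hμ := pi_laplaceMeasure_map_add_le (b := 12 / ε) (by positivity) a.2.1
  have hγ := pi_map_le_of_map_le
    (fun _ : Fin N => Measure.pi fun _ : Fin k => laplaceMeasure (3 * k / ε))
    (fun j z i => z i + a.2.2 j i) (fun j => by fun_prop)
    (fun j => ∑ i, |a.2.2 j i| / (3 * k / ε)) (fun j => by
      rcases Nat.eq_zero_or_pos k with rfl | hk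
      · have : (fun (z : Fin 0 → ℝ) i => z i + a.2.2 j i) = id := by
          funext z i
          exact i.elim0
        simp [this]
      · have : (0 : ℝ) < k := Nat.cast_pos.2 hk
        exact pi_laplaceMeasure_map_add_le (by positivity) (a.2.2 j))
  have h := prod_map_le_of_map_le (by fun_prop) (by fun_prop) hτ
    (prod_map_le_of_map_le (by fun_prop) (by fun_prop) hμ hγ)
  refine h.trans fun s => ?_
  rw [Measure.smul_apply, Measure.smul_apply]
  refine mul_le_mul_left (ENNReal.ofReal_le_ofReal (Real.exp_le_exp.2 ?_)) _
  rw [← Finset.sum_div, ← Finset.sum_div, Finset.sum_comm]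
  have e1 : (∑ j, |a.1 j|) / (6 / ε) ≤ 1 / (6 / ε) := by gcongr
  have e2 : (∑ t, |a.2.1 t|) / (12 / ε) ≤ 2 / (12 / ε) := by gcongr
  have e3 : (∑ i, ∑ j, |a.2.2 j i| / (3 * k / ε)) ≤ ε / 3 := by
    calc (∑ i, ∑ j, |a.2.2 j i| / (3 * k / ε)) ≤ ∑ _i : Fin k, 1 / (3 * k / ε) := by
          refine Finset.sum_le_sum fun i _ => ?_
          rw [← Finset.sum_div]
          gcongr
          exact h₃ i
      _ ≤ ε / 3 := by
          rcases Nat.eq_zero_or_pos k with rfl | hk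
          · simp
            positivity
          · have : (0 : ℝ) < k := Nat.cast_pos.2 hk
            rw [Finset.sum_const, Finset.card_univ, Fintype.card_fin, nsmul_eq_mul]
            apply le_of_eq
            field_simp
  have e4 : 1 / (6 / ε) = ε / 6 := by field_simp
  have e5 : 2 / (12 / ε) = ε / 6 := by field_simp; norm_num
  linarith

/-! ### The hybrid machine -/

/-- The deterministic parameters of the mechanism. -/
structure MechParams (d k : ℕ) where
  /-- The queries. -/
  g : Fin k → (Fin d → ℝ) → ℝ
  /-- The initial noisy histogram. -/
  s₀ : Fin d → ℝ
  /-- The threshold parameter. -/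
  K : ℝ
  /-- The slack. -/
  C : ℝ

/-- The variables of the mechanism except for the noisy thresholds, which are the thresholds plus
the noise of the current interval. -/
structure CoreState (d k : ℕ) where
  /-- Number of closed intervals. -/
  closed : ℕ
  /-- Exact counts within the current interval. -/
  count : Fin d → ℕ
  /-- Current noisy histogram. -/
  hist : Fin d → ℝ
  /-- Thresholds. -/
  thresh : Fin k → ℝ
  /-- Inputs inserted into the histogram mechanism so far. -/
  inserted : List (Fin d → ℕ)
  /-- Current output. -/
  out : Fin k → ℝ

/-- What the noises decide in one time step: `none` if the current interval stays open; `some b` if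
it is closed, where `b i` says whether the `i`-th threshold is raised. -/
abbrev StepEvent (k : ℕ) : Type := Option (Fin k → Bool)

/-- A stream, extended by zeros to all times. -/
def natStream {d T : ℕ} (x : BinStream d T) (t : ℕ) (i : Fin d) : ℕ :=
  if h : t < T then (x ⟨t, h⟩ i : ℕ) else 0

/-- The threshold noise of interval `j`, extended by zero. -/
def tauAt {T N k : ℕ} (ν : Noise T N k) (j : ℕ) : ℝ :=
  if h : j < N + 1 then ν.1 ⟨j, h⟩ else 0

/-- The query noise at time `t`, extended by zero. -/
def muAt {T N k : ℕ} (ν : Noise T N k) (t : ℕ) : ℝ :=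
  if h : t < T then ν.2.1 ⟨t, h⟩ else 0

/-- The update noise of interval `j` and query `i`, extended by zero. -/
def gammaAt {T N k : ℕ} (ν : Noise T N k) (j : ℕ) (i : Fin k) : ℝ :=
  if h : j < N then ν.2.2 ⟨j, h⟩ i else 0

theorem measurable_tauAt {T N k : ℕ} (j : ℕ) :
    Measurable fun ν : Noise T N k => tauAt ν j := by
  unfold tauAt
  split_ifs <;> fun_prop

theorem measurable_muAt {T N k : ℕ} (t : ℕ) :
    Measurable fun ν : Noise T N k => muAt ν t := by
  unfold muAt
  split_ifs <;> fun_prop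

theorem measurable_gammaAt {T N k : ℕ} (j : ℕ) (i : Fin k) :
    Measurable fun ν : Noise T N k => gammaAt ν j i := by
  unfold gammaAt
  split_ifs <;> fun_prop

/-- Coordinatewise sum of a real and an integral vector. -/
def addNat {d : ℕ} (s : Fin d → ℝ) (u : Fin d → ℕ) : Fin d → ℝ := fun i => s i + (u i : ℝ)

namespace MechParams

variable {d k T N : ℕ} (M : MechParams d k)

/-- The state before the first time step. -/
def start : CoreState d k where
  closed := 0
  count := 0
  hist := M.s₀
  thresh := fun _ => M.K
  inserted := []
  out := fun i => M.g i 0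

/-- The effect of one time step with a given event. The vector `u` is added to the noisy histogram
and the vector `v` to the exact counts; `ρ` answers the insertions. -/
def advance (ρ : List (Fin d → ℕ) → Fin d → ℝ) (u v : Fin d → ℕ) (σ : CoreState d k) :
    StepEvent k → CoreState d k
  | none => { σ with count := σ.count + v, hist := addNat σ.hist u }
  | some b =>
    { closed := σ.closed + 1
      count := 0
      hist := ρ (σ.inserted ++ [σ.count + v])
      thresh := fun i => if b i then σ.thresh i + M.K else σ.thresh i
      inserted := σ.inserted ++ [σ.count + v]
      out := fun i => M.g i (ρ (σ.inserted ++ [σ.count + v])) }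

open Classical in
/-- The event of time step `t` with input `u`, as decided by the noises. -/
noncomputable def event (ν : Noise T N k) (t : ℕ) (u : Fin d → ℕ) (σ : CoreState d k) :
    StepEvent k :=
  if (∃ i, M.g i (addNat σ.hist u) + muAt ν t > σ.thresh i + tauAt ν σ.closed) ∧
      σ.closed < N ∧ t < T then
    some fun i => decide (M.g i (addNat σ.hist u) + gammaAt ν σ.closed i > σ.thresh i - M.C)
  else none

variable (x y : ℕ → Fin d → ℕ) (ρ : List (Fin d → ℕ) → Fin d → ℝ)

/-- The hybrid machine: the stream `x` drives the noisy histogram, and so all decisions, while the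
stream `y` drives the exact counts which are inserted into the histogram mechanism. -/
noncomputable def run (ν : Noise T N k) : ℕ → CoreState d k
  | 0 => M.start
  | t + 1 => M.advance ρ (x t) (y t) (run ν t) (M.event ν t (x t) (run ν t))

/-- The sequence of events in a run of the hybrid machine. -/
noncomputable def trace (ν : Noise T N k) (t : ℕ) : StepEvent k :=
  M.event ν t (x t) (M.run x y ρ ν t)

/-- The states of the hybrid machine when the events are prescribed. -/
def replay (η : ℕ → StepEvent k) : ℕ → CoreState d k
  | 0 => M.start
  | t + 1 => M.advance ρ (x t) (y t) (replay η t) (η t)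

end MechParams

/-- The number of intervals closed before time `t`. -/
def closedAt {k : ℕ} (η : ℕ → StepEvent k) : ℕ → ℕ
  | 0 => 0
  | t + 1 => if (η t).isSome then closedAt η t + 1 else closedAt η t

theorem closedAt_mono {k : ℕ} (η : ℕ → StepEvent k) : Monotone (closedAt η) := by
  refine monotone_nat_of_le_succ fun t => ?_
  rw [closedAt]
  split_ifs <;> omega

theorem closedAt_succ_of_isSome {k : ℕ} {η : ℕ → StepEvent k} {t : ℕ} (h : (η t).isSome) :
    closedAt η (t + 1) = closedAt η t + 1 := by
  rw [closedAt, if_pos h]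

theorem closedAt_succ_of_eq_none {k : ℕ} {η : ℕ → StepEvent k} {t : ℕ} (h : η t = none) :
    closedAt η (t + 1) = closedAt η t := by
  simp [closedAt, h]

/-- A finite sequence of events, continued by `none`. -/
def padEvents {k T : ℕ} (η : Fin T → StepEvent k) (t : ℕ) : StepEvent k :=
  if h : t < T then η ⟨t, h⟩ else none

namespace MechParams

variable {d k T N : ℕ} (M : MechParams d k)
variable (x y : ℕ → Fin d → ℕ) (ρ : List (Fin d → ℕ) → Fin d → ℝ)

theorem event_eq_none_iff {ν : Noise T N k} {t : ℕ} {u : Fin d → ℕ} {σ : CoreState d k} :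
    M.event ν t u σ = none ↔
      ¬ ((∃ i, M.g i (addNat σ.hist u) + muAt ν t > σ.thresh i + tauAt ν σ.closed) ∧
        σ.closed < N ∧ t < T) := by
  rw [event]
  split_ifs with h <;> simp [h]

theorem event_eq_some_iff {ν : Noise T N k} {t : ℕ} {u : Fin d → ℕ} {σ : CoreState d k}
    {b : Fin k → Bool} :
    M.event ν t u σ = some b ↔
      ((∃ i, M.g i (addNat σ.hist u) + muAt ν t > σ.thresh i + tauAt ν σ.closed) ∧
        σ.closed < N ∧ t < T) ∧
      ∀ i, M.g i (addNat σ.hist u) + gammaAt ν σ.closed i > σ.thresh i - M.C ↔ b i = true := by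
  rw [event]
  split_ifs with h
  · rw [Option.some.injEq, funext_iff, and_iff_right h]
    exact forall_congr' fun i => by rw [Bool.eq_iff_iff, decide_eq_true_eq]
  · simp [h]

theorem event_eq_none_of_le (ν : Noise T N k) {t : ℕ} (ht : T ≤ t) (u : Fin d → ℕ)
    (σ : CoreState d k) : M.event ν t u σ = none := by
  rw [event_eq_none_iff]
  rintro ⟨_, _, h⟩
  omega

theorem run_eq_replay (ν : Noise T N k) (t : ℕ) :
    M.run x y ρ ν t = M.replay x y ρ (M.trace x y ρ ν) t := by
  induction t with
  | zero => rfl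
  | succ t ih => rw [run, replay, ← ih, trace]

theorem closed_replay (η : ℕ → StepEvent k) (t : ℕ) :
    (M.replay x y ρ η t).closed = closedAt η t := by
  induction t with
  | zero => rfl
  | succ t ih =>
    rw [replay, closedAt]
    cases h : η t <;> simp [advance, ih]

theorem closed_run (ν : Noise T N k) (t : ℕ) :
    (M.run x y ρ ν t).closed = closedAt (M.trace x y ρ ν) t := by
  rw [run_eq_replay, closed_replay]

theorem length_inserted_run (ν : Noise T N k) (t : ℕ) :
    (M.run x y ρ ν t).inserted.length = (M.run x y ρ ν t).closed := by
  induction t with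
  | zero => rfl
  | succ t ih =>
    rw [run]
    cases M.event ν t (x t) (M.run x y ρ ν t) <;> simp [advance, ih]

theorem closedAt_trace_le (ν : Noise T N k) (t : ℕ) :
    closedAt (M.trace x y ρ ν) t ≤ N := by
  induction t with
  | zero => exact Nat.zero_le _
  | succ t ih =>
    cases h : M.trace x y ρ ν t with
    | none => rwa [closedAt_succ_of_eq_none h]
    | some b =>
      rw [closedAt_succ_of_isSome (by simp [h]), ← closed_run]
      rw [trace, event_eq_some_iff] at h
      exact h.1.2.1

/-- The trace is the unique solution of a fixed point equation: prescribed events are those of the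
run if and only if the noises decide for them in the prescribed states. -/
theorem trace_eq_iff (ν : Noise T N k) (η : ℕ → StepEvent k) :
    M.trace x y ρ ν = η ↔ ∀ t, M.event ν t (x t) (M.replay x y ρ η t) = η t := by
  constructor
  · rintro rfl t
    rw [← run_eq_replay, trace]
  · intro h
    have hrun : ∀ t, M.run x y ρ ν t = M.replay x y ρ η t := by
      intro t
      induction t with
      | zero => rfl
      | succ t ih => rw [run, replay, ih, h]
    funext t
    rw [trace, hrun, h]

theorem padEvents_trace (ν : Noise T N k) :
    padEvents (fun t : Fin T => M.trace x y ρ ν t) = M.trace x y ρ ν := by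
  funext t
  rw [padEvents]
  split_ifs with h
  · rfl
  · rw [trace, event_eq_none_of_le _ _ (not_lt.1 h)]

/-- Once the events are fixed, neither the stream that drives the decisions nor the answers
influence the thresholds. -/
theorem thresh_replay_congr (x' y' : ℕ → Fin d → ℕ) (ρ' : List (Fin d → ℕ) → Fin d → ℝ)
    (η : ℕ → StepEvent k) (t : ℕ) :
    (M.replay x y ρ η t).thresh = (M.replay x' y' ρ' η t).thresh := by
  induction t with
  | zero => rfl
  | succ t ih =>
    rw [replay, replay]
    cases h : η t <;> simp [advance, ih]

theorem inserted_count_replay_congr (x' : ℕ → Fin d → ℕ)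
    (ρ' : List (Fin d → ℕ) → Fin d → ℝ) (η : ℕ → StepEvent k) (t : ℕ) :
    (M.replay x y ρ η t).inserted = (M.replay x' y ρ' η t).inserted ∧
      (M.replay x y ρ η t).count = (M.replay x' y ρ' η t).count := by
  induction t with
  | zero => exact ⟨rfl, rfl⟩
  | succ t ih =>
    rw [replay, replay]
    cases h : η t <;> simp [advance, ih]

theorem out_replay_congr (x' : ℕ → Fin d → ℕ) (η : ℕ → StepEvent k) (t : ℕ) :
    (M.replay x y ρ η t).out = (M.replay x' y ρ η t).out := by
  induction t with
  | zero => rfl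
  | succ t ih =>
    obtain ⟨h₁, h₂⟩ := M.inserted_count_replay_congr x y ρ x' ρ η t
    rw [replay, replay]
    cases h : η t <;> simp [advance, ih, h₁, h₂]

end MechParams

/-! ### The mechanism as a run of the hybrid machine -/

theorem stateAfter_eq_run {d k T N : ℕ} (M : MechParams d k) (H : HistogramMechanism.{u} d)
    (x : BinStream d T) (ν : Noise T N k) (ω : H.Coins) {t : ℕ} (ht : t ≤ T) :
    let σ := M.run (natStream x) (natStream x) (H.respond ω) ν t
    stateAfter M.g H M.s₀ M.K M.C x ν ω t =
      { closed := σ.closed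
        count := σ.count
        hist := σ.hist
        thresh := σ.thresh
        noisyThresh := fun i => σ.thresh i + tauAt ν σ.closed
        inserted := σ.inserted
        out := σ.out } := by
  induction t with
  | zero => simp [stateAfter, initState, MechParams.run, MechParams.start, tauAt]
  | succ t ih =>
    have ht' : t < T := ht
    specialize ih ht'.le
    intro σ
    rw [stateAfter, dif_pos ht', ih]
    simp only [σ, MechParams.run]
    generalize M.run (natStream x) (natStream x) (H.respond ω) ν t = σ'
    have hu : ∀ s : Fin d → ℝ, (fun i => s i + ((x ⟨t, ht'⟩ i : ℕ) : ℝ)) =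
        addNat s (natStream x t) := by
      intro s
      funext i
      simp [addNat, natStream, ht']
    have hc : (fun i => σ'.count i + (x ⟨t, ht'⟩ i : ℕ)) = σ'.count + natStream x t := by
      funext i
      simp [natStream, ht']
    have hμ : ν.2.1 ⟨t, ht'⟩ = muAt ν t := by simp [muAt, ht']
    rw [stepState, MechParams.event]
    simp only [hu, hc, hμ]
    by_cases h : (∃ i, M.g i (addNat σ'.hist (natStream x t)) + muAt ν t >
        σ'.thresh i + tauAt ν σ'.closed) ∧ σ'.closed < N
    · rw [dif_pos h, if_pos ⟨h.1, h.2, ht'⟩]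
      simp [MechParams.advance, tauAt, gammaAt, h.2]
    · rw [dif_neg h, if_neg fun h' => h ⟨h'.1, h'.2.1⟩]
      simp [MechParams.advance]

theorem kQueryMechanism_eq_run {d k T N : ℕ} (M : MechParams d k) (H : HistogramMechanism.{u} d)
    (x : BinStream d T) (p : Noise T N k × H.Coins) :
    kQueryMechanism N M.g H M.s₀ M.K M.C x p =
      fun t : Fin T => (M.run (natStream x) (natStream x) (H.respond p.2) p.1 (t + 1)).out := by
  funext t
  rw [kQueryMechanism, stateAfter_eq_run M H x p.1 p.2 (Nat.succ_le_of_lt t.isLt)]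

/-! ### Measurability -/

namespace MechParams

variable {d k T N : ℕ} (M : MechParams d k)
variable (x y : ℕ → Fin d → ℕ)

/-- The outputs of the hybrid machine at the times `1, …, T`. -/
noncomputable def output (ρ : List (Fin d → ℕ) → Fin d → ℝ) (ν : Noise T N k) :
    Fin T → Fin k → ℝ :=
  fun t => (M.run x y ρ ν (t + 1)).out

variable {Z : Type*} [MeasurableSpace Z] {ρ : Z → List (Fin d → ℕ) → Fin d → ℝ}

theorem measurable_hist_replay (hρ : ∀ l, Measurable fun z => ρ z l) (η : ℕ → StepEvent k)
    (t : ℕ) : Measurable fun z => (M.replay x y (ρ z) η t).hist := by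
  induction t with
  | zero => exact measurable_const
  | succ t ih =>
    simp only [replay]
    cases η t with
    | none =>
      simp only [advance]
      refine measurable_pi_lambda _ fun i => ?_
      exact ((measurable_pi_apply i).comp ih).add_const _
    | some b =>
      simp only [advance,
        fun z => (M.inserted_count_replay_congr x y (ρ z) x (fun _ => 0) η t).1,
        fun z => (M.inserted_count_replay_congr x y (ρ z) x (fun _ => 0) η t).2]
      exact hρ _

theorem measurable_out_replay (hg : ∀ i, Measurable (M.g i)) (hρ : ∀ l, Measurable fun z => ρ z l)
    (η : ℕ → StepEvent k) (t : ℕ) : Measurable fun z => (M.replay x y (ρ z) η t).out := by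
  induction t with
  | zero => exact measurable_const
  | succ t ih =>
    simp only [replay]
    cases η t with
    | none => exact ih
    | some b =>
      simp only [advance,
        fun z => (M.inserted_count_replay_congr x y (ρ z) x (fun _ => 0) η t).1,
        fun z => (M.inserted_count_replay_congr x y (ρ z) x (fun _ => 0) η t).2]
      exact measurable_pi_lambda _ fun i => (hg i).comp (hρ _)

theorem measurableSet_event_eq (hg : ∀ i, Measurable (M.g i)) {σ : Z → CoreState d k} {c : ℕ}
    {θ : Fin k → ℝ} (hc : ∀ z, (σ z).closed = c) (hθ : ∀ z, (σ z).thresh = θ)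
    (hσ : Measurable fun z => (σ z).hist) (t : ℕ) (u : Fin d → ℕ) (e : StepEvent k) :
    MeasurableSet {p : Noise T N k × Z | M.event p.1 t u (σ p.2) = e} := by
  have hq : ∀ i, Measurable fun p : Noise T N k × Z => M.g i (addNat (σ p.2).hist u) := by
    intro i
    refine (hg i).comp (measurable_pi_lambda _ fun i' => ?_)
    exact ((measurable_pi_apply i').comp (hσ.comp measurable_snd)).add_const _
  have hμ : Measurable fun p : Noise T N k × Z => muAt p.1 t :=
    (measurable_muAt t).comp measurable_fst
  have hτ : Measurable fun p : Noise T N k × Z => tauAt p.1 c :=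
    (measurable_tauAt c).comp measurable_fst
  have hγ : ∀ i, Measurable fun p : Noise T N k × Z => gammaAt p.1 c i :=
    fun i => (measurable_gammaAt c i).comp measurable_fst
  have hclose : MeasurableSet {p : Noise T N k × Z |
      (∃ i, M.g i (addNat (σ p.2).hist u) + muAt p.1 t > (σ p.2).thresh i + tauAt p.1 (σ p.2).closed)
        ∧ (σ p.2).closed < N ∧ t < T} := by
    simp only [hc, hθ]
    simp only [Set.ofPred_and, Set.ofPred_exists]
    exact (MeasurableSet.iUnion fun i => measurableSet_lt (hτ.const_add _) ((hq i).add hμ)).inter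
      ((MeasurableSet.const _).inter (MeasurableSet.const _))
  have hupd : ∀ i (v : Bool), MeasurableSet {p : Noise T N k × Z |
      (M.g i (addNat (σ p.2).hist u) + gammaAt p.1 (σ p.2).closed i > (σ p.2).thresh i - M.C) ↔
        v = true} := by
    intro i v
    simp only [hc, hθ]
    have h : MeasurableSet {p : Noise T N k × Z |
        M.g i (addNat (σ p.2).hist u) + gammaAt p.1 c i > θ i - M.C} :=
      measurableSet_lt measurable_const ((hq i).add (hγ i))
    cases v with
    | true => simpa using h
    | false =>
      convert h.compl using 1
      ext p
      simp
  cases e with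
  | none =>
    simp only [event_eq_none_iff]
    exact hclose.compl
  | some b =>
    simp only [event_eq_some_iff, Set.ofPred_and (q := fun _ => ∀ _, _), Set.ofPred_forall]
    exact hclose.inter (MeasurableSet.iInter fun i => hupd i (b i))

theorem measurableSet_trace_eq (hg : ∀ i, Measurable (M.g i)) (hρ : ∀ l, Measurable fun z => ρ z l)
    (η : ℕ → StepEvent k) :
    MeasurableSet {p : Noise T N k × Z | M.trace x y (ρ p.2) p.1 = η} := by
  simp only [trace_eq_iff, Set.ofPred_forall]
  refine MeasurableSet.iInter fun t => ?_
  exact M.measurableSet_event_eq hg (fun z => M.closed_replay x y (ρ z) η t)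
    (fun z => M.thresh_replay_congr x y (ρ z) x y (fun _ => 0) η t)
    (M.measurable_hist_replay x y hρ η t) t (x t) (η t)

theorem measurableSet_trace_mem (hg : ∀ i, Measurable (M.g i))
    (hρ : ∀ l, Measurable fun z => ρ z l) (W : Set (ℕ → StepEvent k)) :
    MeasurableSet {p : Noise T N k × Z | M.trace x y (ρ p.2) p.1 ∈ W} := by
  have h : {p : Noise T N k × Z | M.trace x y (ρ p.2) p.1 ∈ W} =
      ⋃ η : {η : Fin T → StepEvent k // padEvents η ∈ W},
        {p : Noise T N k × Z | M.trace x y (ρ p.2) p.1 = padEvents η.1} := by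
    ext p
    simp only [Set.mem_ofPred_eq, Set.mem_iUnion]
    constructor
    · intro hp
      exact ⟨⟨fun t => M.trace x y (ρ p.2) p.1 t, by rwa [padEvents_trace]⟩,
        (M.padEvents_trace x y (ρ p.2) p.1).symm⟩
    · rintro ⟨η, hη⟩
      rw [hη]
      exact η.2
  rw [h]
  exact MeasurableSet.iUnion fun η => M.measurableSet_trace_eq x y hg hρ _

theorem output_eq_of_trace_eq {ρ : List (Fin d → ℕ) → Fin d → ℝ} {ν : Noise T N k}
    {η : ℕ → StepEvent k} (h : M.trace x y ρ ν = η) :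
    M.output x y ρ ν = fun t : Fin T => (M.replay x y ρ η (t + 1)).out := by
  funext t
  rw [output, run_eq_replay, h]

theorem measurable_output (hg : ∀ i, Measurable (M.g i)) (hρ : ∀ l, Measurable fun z => ρ z l) :
    Measurable fun p : Noise T N k × Z => M.output x y (ρ p.2) p.1 := by
  intro S hS
  have h : (fun p : Noise T N k × Z => M.output x y (ρ p.2) p.1) ⁻¹' S =
      ⋃ η : Fin T → StepEvent k,
        {p : Noise T N k × Z | M.trace x y (ρ p.2) p.1 = padEvents η} ∩
          (fun p : Noise T N k × Z =>
            fun t : Fin T => (M.replay x y (ρ p.2) (padEvents η) (t + 1)).out) ⁻¹' S := by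
    ext p
    simp only [Set.mem_preimage, Set.mem_iUnion, Set.mem_inter_iff, Set.mem_ofPred_eq]
    constructor
    · intro hp
      refine ⟨fun t => M.trace x y (ρ p.2) p.1 t, (M.padEvents_trace x y (ρ p.2) p.1).symm, ?_⟩
      rwa [← M.output_eq_of_trace_eq x y (M.padEvents_trace x y (ρ p.2) p.1).symm]
    · rintro ⟨η, hη, hp⟩
      rwa [M.output_eq_of_trace_eq x y hη]
  rw [h]
  refine MeasurableSet.iUnion fun η => (M.measurableSet_trace_eq x y hg hρ _).inter ?_
  refine measurableSet_preimage (measurable_pi_lambda _ fun t => ?_) hS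
  exact (M.measurable_out_replay x y hg hρ (padEvents η) (t + 1)).comp measurable_snd

end MechParams

/-! ### Privacy of the decisions -/

theorem sum_abs_ite_le {ι : Type*} [Fintype ι] (p : ι → Prop) [DecidablePred p]
    (hp : ∀ i j, p i → p j → i = j) {a c : ℝ} (hc : 0 ≤ c) (ha : |a| ≤ c) :
    ∑ i, |if p i then a else 0| ≤ c := by
  by_cases h : ∃ i, p i
  · obtain ⟨i, hi⟩ := h
    rw [Finset.sum_eq_single i]
    · simpa [hi] using ha
    · intro j _ hj
      simp [show ¬ p j from fun h => hj (hp _ _ h hi)]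
    · simp
  · rw [not_exists] at h
    simpa [h] using hc

/-- The interval that is open at time `ts` is closed at time `r`. -/
def ClosesAt {k : ℕ} (η : ℕ → StepEvent k) (ts r : ℕ) : Prop :=
  ts ≤ r ∧ closedAt η r = closedAt η ts ∧ (η r).isSome

theorem ClosesAt.unique {k : ℕ} {η : ℕ → StepEvent k} {ts r r' : ℕ} (h : ClosesAt η ts r)
    (h' : ClosesAt η ts r') : r = r' := by
  by_contra hne
  wlog hlt : r < r' generalizing r r'
  · exact this h' h (Ne.symm hne) (by omega)
  have := closedAt_mono η (Nat.succ_le_of_lt hlt)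
  rw [Nat.succ_eq_add_one, closedAt_succ_of_isSome h.2.2, h.2.1, h'.2.1] at this
  omega

namespace MechParams

variable {d k T N : ℕ} (M : MechParams d k)
variable (x y : ℕ → Fin d → ℕ) (ρ : List (Fin d → ℕ) → Fin d → ℝ)

/-- The noisy histogram on which the decisions of time step `t` are based. -/
def queryHist (z : ℕ → Fin d → ℕ) (η : ℕ → StepEvent k) (t : ℕ) : Fin d → ℝ :=
  addNat (M.replay z y ρ η t).hist (z t)

variable {x y}

/-- For streams that differ only at time `ts`, the noisy histograms differ only within the interval
that is open at time `ts`, and there by the difference of the two inputs. -/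
theorem queryHist_eq_or {ts : ℕ} (hxy : ∀ t, t ≠ ts → x t = y t) (η : ℕ → StepEvent k) (t : ℕ) :
    M.queryHist y ρ x η t = M.queryHist y ρ y η t ∨
      ts ≤ t ∧ closedAt η t = closedAt η ts ∧
        ∀ i, M.queryHist y ρ x η t i - M.queryHist y ρ y η t i = (x ts i : ℝ) - y ts i := by
  have hist : ∀ t, (M.replay x y ρ η t).hist = (M.replay y y ρ η t).hist ∨
      ts < t ∧ closedAt η t = closedAt η ts ∧
        ∀ i, (M.replay x y ρ η t).hist i - (M.replay y y ρ η t).hist i =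
          (x ts i : ℝ) - y ts i := by
    intro t
    induction t with
    | zero => exact Or.inl rfl
    | succ t ih =>
      obtain ⟨h₁, h₂⟩ := M.inserted_count_replay_congr x y ρ y ρ η t
      rw [replay, replay]
      cases he : η t with
      | some b => left; simp [advance, h₁, h₂]
      | none =>
        rw [closedAt_succ_of_eq_none he]
        simp only [advance, addNat]
        rcases ih with ih | ⟨hlt, hcl, ih⟩
        · by_cases ht : t = ts
          · subst ht
            right
            refine ⟨Nat.lt_succ_self _, rfl, fun i => ?_⟩
            rw [ih]
            ring
          · left
            rw [ih, hxy t ht]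
        · right
          refine ⟨by omega, hcl, fun i => ?_⟩
          rw [← ih i, hxy t (by omega)]
          ring
  rcases hist t with h | ⟨hlt, hcl, h⟩
  · by_cases ht : t = ts
    · subst ht
      right
      refine ⟨le_rfl, rfl, fun i => ?_⟩
      simp only [queryHist, addNat, h]
      ring
    · left
      rw [queryHist, queryHist, h, hxy t ht]
  · right
    refine ⟨hlt.le, hcl, fun i => ?_⟩
    rw [← h i]
    simp only [queryHist, addNat, hxy t hlt.ne']
    ring

theorem abs_query_sub_le (hg : ∀ i, IsMonotoneHistogramQuery (M.g i)) {ts : ℕ}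
    (hxy : ∀ t, t ≠ ts → x t = y t) (hts : ∀ i, |(x ts i : ℤ) - y ts i| ≤ 1)
    (η : ℕ → StepEvent k) (t : ℕ) (i : Fin k) :
    |M.g i (M.queryHist y ρ x η t) - M.g i (M.queryHist y ρ y η t)| ≤ 1 := by
  rcases M.queryHist_eq_or ρ hxy η t with h | ⟨_, _, h⟩
  · simp [h]
  · refine (hg i).sensitivity _ _ ((pi_norm_le_iff_of_nonneg zero_le_one).2 fun l => ?_)
    rw [Pi.sub_apply, h l, Real.norm_eq_abs]
    exact_mod_cast hts l

open Classical in
/-- The translation of the noises that makes up for replacing `x` by `y` when the events are `η`: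
the noise of the thresholds in the interval open at time `ts` grows by `1`, the noise of the
queries at the time when this interval is closed grows by `2`, and the noises of the subsequent
update of the thresholds grow by what the query values lose. -/
noncomputable def compensation (x y : ℕ → Fin d → ℕ) (η : ℕ → StepEvent k) (ts : ℕ) :
    Noise T N k :=
  (fun j => if (j : ℕ) = closedAt η ts then 1 else 0,
    fun t => if ClosesAt η ts t then 2 else 0,
    fun j i => if (j : ℕ) = closedAt η ts then
      (if h : ∃ r, ClosesAt η ts r then
        M.g i (M.queryHist y ρ x η h.choose) - M.g i (M.queryHist y ρ y η h.choose) else 0) else 0)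

theorem noiseMeasure_map_compensation_le {ε : ℝ} (hε : 0 < ε)
    (hg : ∀ i, IsMonotoneHistogramQuery (M.g i)) {ts : ℕ}
    (hxy : ∀ t, t ≠ ts → x t = y t) (hts : ∀ i, |(x ts i : ℤ) - y ts i| ≤ 1)
    (η : ℕ → StepEvent k) :
    (noiseMeasure T N k ε).map (shiftNoise (M.compensation ρ x y η ts)) ≤
      ENNReal.ofReal (Real.exp (2 * ε / 3)) • noiseMeasure T N k ε := by
  classical
  refine noiseMeasure_map_shiftNoise_le hε _ ?_ ?_ fun i => ?_
  · refine sum_abs_ite_le _ (fun i j hi hj => Fin.ext (hi.trans hj.symm)) zero_le_one (by simp)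
  · exact sum_abs_ite_le _ (fun i j hi hj => Fin.ext (hi.unique hj)) zero_le_two (by simp)
  · refine sum_abs_ite_le _ (fun i j hi hj => Fin.ext (hi.trans hj.symm)) zero_le_one ?_
    split_ifs with h
    · exact M.abs_query_sub_le ρ hg hxy hts η _ i
    · simp

/-- The translated noises lead to the same event in time step `t`. -/
theorem event_shiftNoise (hg : ∀ i, IsMonotoneHistogramQuery (M.g i)) {ts : ℕ}
    (hxy : ∀ t, t ≠ ts → x t = y t) (hts : ∀ i, |(x ts i : ℤ) - y ts i| ≤ 1)
    (η : ℕ → StepEvent k) (ν : Noise T N k) (t : ℕ)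
    (h : M.event ν t (x t) (M.replay x y ρ η t) = η t) :
    M.event (shiftNoise (M.compensation ρ x y η ts) ν) t (y t) (M.replay y y ρ η t) = η t := by
  have habs := fun i => abs_le.1 (M.abs_query_sub_le ρ hg hxy hts η t i)
  have heq := M.queryHist_eq_or ρ hxy η t
  have hfold : ∀ z, addNat (M.replay z y ρ η t).hist (z t) = M.queryHist y ρ z η t := fun _ => rfl
  have hthr := M.thresh_replay_congr x y ρ y y ρ η t
  cases he : η t with
  | none =>
    rw [he, event_eq_none_iff, closed_replay, hthr, hfold] at h
    rw [event_eq_none_iff, closed_replay, hfold]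
    -- before the closing, the growth of the threshold noise outweighs that of the query values
    rintro ⟨⟨i, hi⟩, hN, hT⟩
    refine h ⟨⟨i, ?_⟩, hN, hT⟩
    have hclose : ¬ ClosesAt η ts t := fun h' => by simpa [he] using h'.2.2
    have hN' : closedAt η t < N + 1 := hN.trans (Nat.lt_succ_self N)
    simp only [tauAt, muAt, hT, hN', dif_pos, shiftNoise, Prod.map, compensation, hclose,
      if_false, add_zero] at hi ⊢
    by_cases hcl : closedAt η t = closedAt η ts
    · rw [if_pos hcl] at hi
      linarith [(habs i).1]
    · rw [if_neg hcl] at hi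
      rw [heq.resolve_right fun h' => hcl h'.2.1]
      linarith
  | some b =>
    rw [he, event_eq_some_iff, closed_replay, hthr, hfold] at h
    rw [event_eq_some_iff, closed_replay, hfold]
    obtain ⟨⟨⟨i, hi⟩, hN, hT⟩, hb⟩ := h
    have hN' : closedAt η t < N + 1 := hN.trans (Nat.lt_succ_self N)
    simp only [tauAt, muAt, gammaAt, hN, hT, hN', dif_pos, and_true, shiftNoise, Prod.map,
      compensation] at hi hb ⊢
    by_cases hcl : closedAt η t = closedAt η ts
    · -- the interval is still open at time `ts`, so it cannot have been closed earlier
      have hle : ts ≤ t := by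
        by_contra hlt
        have := closedAt_mono η (Nat.succ_le_of_lt (not_le.1 hlt))
        rw [Nat.succ_eq_add_one, closedAt_succ_of_isSome (by simp [he]), hcl] at this
        omega
      have hclose : ClosesAt η ts t := ⟨hle, hcl, by simp [he]⟩
      have hex : ∃ r, ClosesAt η ts r := ⟨t, hclose⟩
      have hr : hex.choose = t := hex.choose_spec.unique hclose
      simp only [hcl, hclose, if_true, hex, dif_pos, hr]
      refine ⟨⟨i, by simp only [hcl] at hi; linarith [(habs i).2]⟩, fun i => ?_⟩
      simp only [hcl] at hb
      rw [← hb i]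
      ring_nf
    · have hclose : ¬ ClosesAt η ts t := fun h' => hcl h'.2.1
      simp only [hcl, hclose, if_false, add_zero, ← heq.resolve_right fun h' => hcl h'.2.1]
      exact ⟨⟨i, hi⟩, hb⟩

/-- For fixed coins of the histogram mechanism, replacing the stream that drives the decisions by
a neighboring one costs privacy `2 ε / 3`. -/
theorem noiseMeasure_output_mem_le {ε : ℝ} (hε : 0 < ε)
    (hg : ∀ i, IsMonotoneHistogramQuery (M.g i)) {ts : ℕ}
    (hxy : ∀ t, t ≠ ts → x t = y t) (hts : ∀ i, |(x ts i : ℤ) - y ts i| ≤ 1)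
    (S : Set (Fin T → Fin k → ℝ)) :
    noiseMeasure T N k ε {ν | M.output x y ρ ν ∈ S} ≤
      ENNReal.ofReal (Real.exp (2 * ε / 3)) *
        noiseMeasure T N k ε {ν | M.output y y ρ ν ∈ S} := by
  classical
  -- the prescribed events that lead to an output in `S`; the output is the same for `x` and `y`
  let I := {η : Fin T → StepEvent k //
    (fun t : Fin T => (M.replay y y ρ (padEvents η) (t + 1)).out) ∈ S}
  have hsplit : ∀ z : ℕ → Fin d → ℕ, {ν : Noise T N k | M.output z y ρ ν ∈ S} =
      ⋃ η : I, {ν : Noise T N k | M.trace z y ρ ν = padEvents η.1} := by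
    intro z
    ext ν
    simp only [Set.mem_ofPred_eq, Set.mem_iUnion]
    constructor
    · intro h
      have ht := (M.padEvents_trace z y ρ ν).symm
      refine ⟨⟨fun t => M.trace z y ρ ν t, ?_⟩, ht⟩
      rw [M.output_eq_of_trace_eq z y ht] at h
      simpa only [M.out_replay_congr z y ρ y] using h
    · rintro ⟨η, hη⟩
      rw [M.output_eq_of_trace_eq z y hη]
      simpa only [M.out_replay_congr z y ρ y] using η.2
  -- the map `ν ↦ (ν, ())` turns the statement with parameters into one for a single `ρ`
  have hmeas : ∀ η : I, MeasurableSet {ν : Noise T N k | M.trace y y ρ ν = padEvents η.1} :=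
    fun η => measurableSet_preimage (f := fun ν : Noise T N k => (ν, ())) (by fun_prop)
      (M.measurableSet_trace_eq (ρ := fun _ : Unit => ρ) y y (fun i => (hg i).measurable)
        (fun _ => measurable_const) (padEvents η.1))
  have hdisj : Pairwise (Function.onFun Disjoint
      fun η : I => {ν : Noise T N k | M.trace y y ρ ν = padEvents η.1}) := by
    intro η η' hne
    refine Set.disjoint_left.2 fun ν h h' => hne ?_
    have hpad : padEvents η.1 = padEvents η'.1 := h.symm.trans h'
    refine Subtype.ext (funext fun t => ?_)
    simpa [padEvents] using congrFun hpad t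
  rw [hsplit x, hsplit y, measure_iUnion hdisj hmeas, ← ENNReal.tsum_mul_left]
  refine (measure_iUnion_le _).trans (ENNReal.tsum_le_tsum fun η => ?_)
  calc noiseMeasure T N k ε {ν | M.trace x y ρ ν = padEvents η.1}
      ≤ noiseMeasure T N k ε (shiftNoise (M.compensation ρ x y (padEvents η.1) ts) ⁻¹'
          {ν | M.trace y y ρ ν = padEvents η.1}) := by
        refine measure_mono fun ν hν => ?_
        simp only [Set.mem_ofPred_eq, Set.mem_preimage, trace_eq_iff] at hν ⊢
        exact fun t => M.event_shiftNoise ρ hg hxy hts _ ν t (hν t)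
    _ = (noiseMeasure T N k ε).map (shiftNoise (M.compensation ρ x y (padEvents η.1) ts))
          {ν | M.trace y y ρ ν = padEvents η.1} :=
        (Measure.map_apply (measurable_shiftNoise _) (hmeas η)).symm
    _ ≤ _ := M.noiseMeasure_map_compensation_le ρ hε hg hxy hts (padEvents η.1) _

end MechParams

/-! ### The adversary that simulates the mechanism -/

/-- Responses that answer the `j`-th insertion by the `j`-th entry of a given tuple, whatever is
inserted; insertions beyond the end of the tuple are answered by zero. -/
def answersOf {d n : ℕ} (a : Fin n → Fin d → ℝ) : List (Fin d → ℕ) → Fin d → ℝ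
  | [] => 0
  | _ :: l => if h : l.length < n then a ⟨l.length, h⟩ else 0

theorem measurable_answersOf {d n : ℕ} (l : List (Fin d → ℕ)) :
    Measurable fun a : Fin n → Fin d → ℝ => answersOf a l := by
  cases l with
  | nil => exact measurable_const
  | cons _ l =>
    simp only [answersOf]
    split_ifs <;> fun_prop

theorem answersOf_congr_length {d n : ℕ} (a : Fin n → Fin d → ℝ) {l l' : List (Fin d → ℕ)}
    (h : l.length = l'.length) : answersOf a l = answersOf a l' := by
  cases l <;> cases l' <;> simp_all [answersOf]

theorem answersOf_castLE {d n N : ℕ} (hn : n ≤ N) (a : Fin N → Fin d → ℝ)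
    {l : List (Fin d → ℕ)} (hl : l.length ≤ n) :
    answersOf (fun i => a (Fin.castLE hn i)) l = answersOf a l := by
  cases l with
  | nil => rfl
  | cons _ l =>
    have h : l.length < n := hl
    simp [answersOf, h, h.trans_le hn]

theorem answersOf_eq {d N n : ℕ} (a : Fin N → Fin d → ℝ) {l : List (Fin d → ℕ)} (hn : n < N)
    (hl : l.length = n + 1) : answersOf a l = a ⟨n, hn⟩ := by
  cases l with
  | nil => simp at hl
  | cons _ l =>
    obtain rfl : l.length = n := by simpa using hl
    simp [answersOf, hn]

/-- The sum of a stream over the interval number `j`. -/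
def intervalSum {d k : ℕ} (T : ℕ) (z : ℕ → Fin d → ℕ) (η : ℕ → StepEvent k) (j : ℕ) : Fin d → ℕ :=
  ∑ t ∈ Finset.range T, if closedAt η t = j then z t else 0

/-- The move of the simulating adversary in round `n`. The challenge is made in the round of the
interval that contains `ts`, and no later than in the last round. -/
def nextMove {d k : ℕ} (T N : ℕ) (x y : ℕ → Fin d → ℕ) (ts : ℕ) (η : ℕ → StepEvent k) (n : ℕ) :
    AdvMove d :=
  if min (closedAt η ts) (N - 1) = n then .challenge (intervalSum T x η n) (intervalSum T y η n)
  else .regular (intervalSum T x η n)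

/-- The stream inserted into the histogram mechanism when the game is played with a given side. -/
def Side.pick {α : Type*} (x y : α) : Side → α
  | .L => x
  | .R => y

theorem intervalSum_congr {d k T : ℕ} {x y : ℕ → Fin d → ℕ} {ts : ℕ}
    (hxy : ∀ t, t ≠ ts → x t = y t) {η : ℕ → StepEvent k} {j : ℕ} (hj : closedAt η ts ≠ j) :
    intervalSum T x η j = intervalSum T y η j := by
  refine Finset.sum_congr rfl fun t _ => ?_
  by_cases ht : t = ts
  · simp [ht, hj]
  · rw [hxy t ht]

theorem abs_intervalSum_sub_le {d k T : ℕ} {x y : ℕ → Fin d → ℕ} {ts : ℕ}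
    (hxy : ∀ t, t ≠ ts → x t = y t) (hts : ∀ i, |(x ts i : ℤ) - y ts i| ≤ 1)
    (η : ℕ → StepEvent k) (j : ℕ) (i : Fin d) :
    |(intervalSum T x η j i : ℤ) - intervalSum T y η j i| ≤ 1 := by
  simp only [intervalSum, Finset.sum_apply, Nat.cast_sum, ← Finset.sum_sub_distrib]
  by_cases h : ts ∈ Finset.range T
  · rw [Finset.sum_eq_single_of_mem ts h fun t _ ht => by simp [hxy t ht]]
    split_ifs
    · exact hts i
    · simp
  · rw [Finset.sum_eq_zero]
    · simp
    · intro t ht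
      simp [hxy t fun h' => h (h' ▸ ht)]

theorem forward_nextMove {d k T N : ℕ} {x y : ℕ → Fin d → ℕ} {ts : ℕ}
    (hxy : ∀ t, t ≠ ts → x t = y t) (η : ℕ → StepEvent k) {n : ℕ} (hn : n < N) (side : Side) :
    (nextMove T N x y ts η n).forward side = intervalSum T (side.pick x y) η n := by
  rw [nextMove]
  split_ifs with h
  · cases side <;> rfl
  · cases side
    · rfl
    · refine intervalSum_congr hxy fun h' => h ?_
      omega

theorem isChallenge_nextMove {d k T N : ℕ} {x y : ℕ → Fin d → ℕ} {ts : ℕ} {η : ℕ → StepEvent k}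
    {n : ℕ} : (nextMove T N x y ts η n).IsChallenge ↔ min (closedAt η ts) (N - 1) = n := by
  rw [nextMove]
  split_ifs with h <;> simp [AdvMove.IsChallenge, h]

namespace MechParams

variable {d k T N : ℕ} (M : MechParams d k)
variable (x y : ℕ → Fin d → ℕ)

/-- A run is determined by the first `n` answers as long as no more than `n` intervals have been
closed. -/
theorem run_congr_of_closed_le {ρ ρ' : List (Fin d → ℕ) → Fin d → ℝ} {n : ℕ}
    (hρ : ∀ l, l.length ≤ n → ρ l = ρ' l) (ν : Noise T N k) {t : ℕ}
    (ht : (M.run x y ρ ν t).closed ≤ n) : M.run x y ρ' ν t = M.run x y ρ ν t := by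
  induction t with
  | zero => rfl
  | succ t ih =>
    have hlen := M.length_inserted_run x y ρ ν t
    rw [run] at ht
    have hle : (M.run x y ρ ν t).closed ≤ n := by
      refine le_trans ?_ ht
      cases M.event ν t (x t) (M.run x y ρ ν t) <;> simp [advance]
    rw [run, run, ih hle]
    cases he : M.event ν t (x t) (M.run x y ρ ν t) with
    | none => rfl
    | some b =>
      rw [he] at ht
      have : ∀ v, ρ ((M.run x y ρ ν t).inserted ++ [v]) = ρ' ((M.run x y ρ ν t).inserted ++ [v]) :=
        fun v => hρ _ (by simpa [hlen, advance] using ht)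
      simp [advance, this]

theorem closedAt_trace_congr {ρ ρ' : List (Fin d → ℕ) → Fin d → ℝ} {n : ℕ}
    (hρ : ∀ l, l.length ≤ n → ρ l = ρ' l) (ν : Noise T N k) (t : ℕ) :
    closedAt (M.trace x y ρ ν) t = closedAt (M.trace x y ρ' ν) t ∨
      n < closedAt (M.trace x y ρ ν) t ∧ n < closedAt (M.trace x y ρ' ν) t := by
  simp only [← closed_run]
  by_cases h : (M.run x y ρ ν t).closed ≤ n
  · rw [M.run_congr_of_closed_le x y hρ ν h]
    exact Or.inl rfl
  by_cases h' : (M.run x y ρ' ν t).closed ≤ n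
  · rw [M.run_congr_of_closed_le x y (fun l hl => (hρ l hl).symm) ν h']
    exact Or.inl rfl
  · exact Or.inr ⟨not_le.1 h, not_le.1 h'⟩

/-- The move in round `n` depends on the first `n` answers only. -/
theorem nextMove_trace_congr {ρ ρ' : List (Fin d → ℕ) → Fin d → ℝ} {n : ℕ} (hn : n < N)
    (hρ : ∀ l, l.length ≤ n → ρ l = ρ' l) (ν : Noise T N k) (ts : ℕ) :
    nextMove T N x y ts (M.trace x x ρ ν) n = nextMove T N x y ts (M.trace x x ρ' ν) n := by
  have hiff : ∀ t, closedAt (M.trace x x ρ ν) t = n ↔ closedAt (M.trace x x ρ' ν) t = n := by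
    intro t
    have := M.closedAt_trace_congr x x hρ ν t
    omega
  have hts : min (closedAt (M.trace x x ρ ν) ts) (N - 1) = n ↔
      min (closedAt (M.trace x x ρ' ν) ts) (N - 1) = n := by
    have := M.closedAt_trace_congr x x hρ ν ts
    omega
  simp only [nextMove, intervalSum, hiff, hts]

/-- If the answers do not depend on what is inserted, then neither do the decisions and outputs. -/
theorem run_congr_of_length {ρ : List (Fin d → ℕ) → Fin d → ℝ}
    (hρ : ∀ l l', l.length = l'.length → ρ l = ρ l') (y' : ℕ → Fin d → ℕ) (ν : Noise T N k)
    (t : ℕ) :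
    (M.run x y ρ ν t).closed = (M.run x y' ρ ν t).closed ∧
      (M.run x y ρ ν t).hist = (M.run x y' ρ ν t).hist ∧
      (M.run x y ρ ν t).thresh = (M.run x y' ρ ν t).thresh ∧
      (M.run x y ρ ν t).out = (M.run x y' ρ ν t).out := by
  induction t with
  | zero => exact ⟨rfl, rfl, rfl, rfl⟩
  | succ t ih =>
    obtain ⟨h₁, h₂, h₃, h₄⟩ := ih
    have he : M.event ν t (x t) (M.run x y ρ ν t) = M.event ν t (x t) (M.run x y' ρ ν t) := by
      simp only [event, h₁, h₂, h₃]
    have hl := M.length_inserted_run x y ρ ν t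
    have hl' := M.length_inserted_run x y' ρ ν t
    rw [run, run, he]
    cases M.event ν t (x t) (M.run x y' ρ ν t) with
    | none => exact ⟨h₁, congrArg (addNat · (x t)) h₂, h₃, h₄⟩
    | some b =>
      have hr := hρ ((M.run x y ρ ν t).inserted ++ [(M.run x y ρ ν t).count + y t])
        ((M.run x y' ρ ν t).inserted ++ [(M.run x y' ρ ν t).count + y' t])
        (by simp [hl, hl', h₁])
      simp [advance, h₁, h₃, hr]

theorem trace_congr_of_length {ρ : List (Fin d → ℕ) → Fin d → ℝ}
    (hρ : ∀ l l', l.length = l'.length → ρ l = ρ l') (y' : ℕ → Fin d → ℕ) (ν : Noise T N k) :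
    M.trace x y ρ ν = M.trace x y' ρ ν := by
  funext t
  obtain ⟨h₁, h₂, h₃, _⟩ := M.run_congr_of_length x y hρ y' ν t
  simp only [trace, event, h₁, h₂, h₃]

/-- Within the first `T` time steps, the vectors inserted so far are the sums of the stream over
the closed intervals, and the current counts are the sum over the current interval so far. -/
theorem inserted_count_run (ρ : List (Fin d → ℕ) → Fin d → ℝ) (ν : Noise T N k) {t : ℕ}
    (ht : t ≤ T) :
    let η := M.trace x y ρ ν
    (M.run x y ρ ν t).inserted = (List.range (closedAt η t)).map (intervalSum T y η) ∧
      (M.run x y ρ ν t).count =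
        ∑ t' ∈ Finset.range t, if closedAt η t' = closedAt η t then y t' else 0 := by
  intro η
  induction t with
  | zero => exact ⟨rfl, rfl⟩
  | succ t ih =>
    obtain ⟨h₁, h₂⟩ := ih (Nat.le_of_succ_le ht)
    have hcount : (M.run x y ρ ν t).count + y t = ∑ t' ∈ Finset.range (t + 1),
        if closedAt η t' = closedAt η t then y t' else 0 := by
      rw [Finset.sum_range_succ, if_pos rfl, h₂]
    rw [run]
    change (M.advance ρ (x t) (y t) _ (η t)).inserted = _ ∧
      (M.advance ρ (x t) (y t) _ (η t)).count = _
    cases he : η t with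
    | none =>
      rw [closedAt_succ_of_eq_none he]
      exact ⟨h₁, hcount⟩
    | some b =>
      have hs : (η t).isSome := by simp [he]
      rw [closedAt_succ_of_isSome hs]
      constructor
      · have hsum : (M.run x y ρ ν t).count + y t = intervalSum T y η (closedAt η t) := by
          rw [hcount, intervalSum]
          refine Finset.sum_subset (Finset.range_subset_range.2 ht) fun t' _ ht' => if_neg ?_
          have := closedAt_mono η (not_lt.1 (Finset.mem_range.not.1 ht'))
          rw [closedAt_succ_of_isSome hs] at this
          omega
        rw [List.range_succ, List.map_append, ← h₁, List.map_singleton, ← hsum]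
        rfl
      · symm
        refine Finset.sum_eq_zero fun t' ht' => if_neg ?_
        have := closedAt_mono η (Nat.lt_succ_iff.1 (Finset.mem_range.1 ht'))
        omega

variable {x y}

/-- The adversary that simulates the mechanism on the stream `x`. Its coins are the noises, and it
takes the answers in the game for the outputs of the histogram mechanism. The insertions that it
does not need (if fewer than `N` intervals get closed) are sent as regular moves, or as a challenge
if there has been none before. -/
noncomputable def simulator {ε : ℝ} (hε : 0 < ε) (hg : ∀ i, Measurable (M.g i)) (hN : 0 < N)
    {ts : ℕ} (hxy : ∀ t, t ≠ ts → x t = y t) (hts : ∀ i, |(x ts i : ℤ) - y ts i| ≤ 1) :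
    Adversary d N where
  Coins := Noise T N k
  P := noiseMeasure T N k ε
  isProbabilityMeasure := isProbabilityMeasure_noiseMeasure T N k hε
  move n p := nextMove T N x y ts (M.trace x x (answersOf p.2) p.1) n
  measurable_move n W _ :=
    M.measurableSet_trace_mem x x hg measurable_answersOf {η | nextMove T N x y ts η n ∈ W}
  admissible n p := by
    rw [nextMove]
    split_ifs
    · exact abs_intervalSum_sub_le hxy hts _ n
    · trivial
  existsUnique_challenge ν a := by
    have h : ∀ n : Fin N, (nextMove T N x y ts
        (M.trace x x (answersOf fun i => a (i.castLE n.isLt.le)) ν) n).IsChallenge ↔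
          min (closedAt (M.trace x x (answersOf a) ν) ts) (N - 1) = n := by
      intro n
      rw [M.nextMove_trace_congr x y n.isLt (fun l => answersOf_castLE n.isLt.le a) ν ts,
        isChallenge_nextMove]
    refine ⟨⟨min (closedAt (M.trace x x (answersOf a) ν) ts) (N - 1), by omega⟩, (h _).2 rfl, ?_⟩
    intro n hn
    exact Fin.ext ((h n).1 hn).symm

end MechParams

/-! ### Privacy of the insertions -/

theorem gamePlay_snd_castLE {d N : ℕ} (H : HistogramMechanism.{u} d) (A : Adversary d N)
    (side : Side) (α : A.Coins) (ω : H.Coins) {n m : ℕ} (h : n ≤ m) (i : Fin n) :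
    (gamePlay H A side α ω m).2 (i.castLE h) = (gamePlay H A side α ω n).2 i := by
  induction m, h using Nat.le_induction with
  | base => rfl
  | succ m h ih =>
    rw [← ih]
    exact Fin.snoc_castSucc (α := fun _ => Fin d → ℝ) _ _ (i.castLE h)

namespace MechParams

variable {d k T N : ℕ} (M : MechParams d k) {x y : ℕ → Fin d → ℕ}

section Game

variable {ε : ℝ} (hε : 0 < ε) (hg : ∀ i, Measurable (M.g i)) (hN : 0 < N)
    {ts : ℕ} (hxy : ∀ t, t ≠ ts → x t = y t) (hts : ∀ i, |(x ts i : ℤ) - y ts i| ≤ 1)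
    (H : HistogramMechanism.{u} d) (side : Side) (ν : Noise T N k) (ω : H.Coins)

/-- The answers which the simulating adversary receives during the game. -/
noncomputable def gameAnswers : Fin N → Fin d → ℝ :=
  (gamePlay H (M.simulator hε hg hN hxy hts) side ν ω N).2

/-- In the game with the simulating adversary, the histogram mechanism receives the sums of the
stream of the given side over the intervals. -/
theorem gamePlay_simulator_fst {n : ℕ} (hn : n ≤ N) :
    (gamePlay H (M.simulator hε hg hN hxy hts) side ν ω n).1 =
      (List.range n).map (intervalSum T (side.pick x y)
        (M.trace x x (answersOf (M.gameAnswers hε hg hN hxy hts H side ν ω)) ν)) := by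
  induction n with
  | zero => rfl
  | succ n ih =>
    have hle : n ≤ N := Nat.le_of_succ_le hn
    have hprefix : (fun i => M.gameAnswers hε hg hN hxy hts H side ν ω (Fin.castLE hle i)) =
        (gamePlay H (M.simulator hε hg hN hxy hts) side ν ω n).2 :=
      funext (gamePlay_snd_castLE H (M.simulator hε hg hN hxy hts) side ν ω hle)
    have hans := fun l => answersOf_castLE hle (M.gameAnswers hε hg hN hxy hts H side ν ω) (l := l)
    rw [hprefix] at hans
    rw [List.range_succ, List.map_append, ← ih hle, List.map_singleton,
      ← forward_nextMove hxy _ hn side, ← M.nextMove_trace_congr x y hn hans ν ts]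
    rfl

theorem gameAnswers_apply {n : ℕ} (hn : n < N) :
    M.gameAnswers hε hg hN hxy hts H side ν ω ⟨n, hn⟩ =
      H.respond ω ((List.range (n + 1)).map (intervalSum T (side.pick x y)
        (M.trace x x (answersOf (M.gameAnswers hε hg hN hxy hts H side ν ω)) ν))) := by
  rw [← M.gamePlay_simulator_fst hε hg hN hxy hts H side ν ω hn]
  have h := gamePlay_snd_castLE H (M.simulator hε hg hN hxy hts) side ν ω
    (Nat.succ_le_of_lt hn) (Fin.last n)
  refine Eq.trans h ?_
  exact Fin.snoc_last (α := fun _ => Fin d → ℝ) _ _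

/-- A run of the hybrid machine with the histogram mechanism is the simulation with the answers
given in the game. -/
theorem run_respond_eq {t : ℕ} (ht : t ≤ T) :
    M.run x (side.pick x y) (H.respond ω) ν t = M.run x (side.pick x y)
      (answersOf (M.gameAnswers hε hg hN hxy hts H side ν ω)) ν t := by
  induction t with
  | zero => rfl
  | succ t ih =>
    rw [run, run, ih (Nat.le_of_succ_le ht)]
    set a := M.gameAnswers hε hg hN hxy hts H side ν ω with ha
    set z := side.pick x y
    have htr : M.trace x z (answersOf a) ν = M.trace x x (answersOf a) ν :=
      M.trace_congr_of_length x z (fun l l' => answersOf_congr_length a) x ν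
    have hins := (M.inserted_count_run x z (answersOf a) ν ht).1
    have hlen := M.length_inserted_run x z (answersOf a) ν (t + 1)
    have hle := M.closedAt_trace_le x z (answersOf a) ν (t + 1)
    rw [← closed_run] at hins hle
    rw [run] at hins hlen hle
    cases he : M.event ν t (x t) (M.run x z (answersOf a) ν t) with
    | none => rfl
    | some b =>
      rw [he] at hins hlen hle
      simp only [advance] at hins hlen hle ⊢
      have hans := M.gameAnswers_apply hε hg hN hxy hts H side ν ω hle
      rw [← ha, ← htr, ← hins, ← answersOf_eq a hle hlen] at hans
      rw [hans]

theorem output_respond_eq :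
    M.output x (side.pick x y) (H.respond ω) ν =
      M.output x x (answersOf (M.gameAnswers hε hg hN hxy hts H side ν ω)) ν := by
  funext t
  rw [output, M.run_respond_eq hε hg hN hxy hts H side ν ω (Nat.succ_le_of_lt t.isLt)]
  exact (M.run_congr_of_length x _ (fun l l' => answersOf_congr_length _) x ν _).2.2.2

end Game

/-- Replacing the stream that is inserted into `H` by a neighboring one costs the privacy of `H`. -/
theorem prod_output_mem_le {ε : ℝ} (hε : 0 < ε) (hg : ∀ i, Measurable (M.g i)) (hN : 0 < N)
    {ts : ℕ} (hxy : ∀ t, t ≠ ts → x t = y t) (hts : ∀ i, |(x ts i : ℤ) - y ts i| ≤ 1)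
    (H : HistogramMechanism.{u} d) {ε' : ℝ} (hH : H.IsAdaptivelyDP N ε')
    {S : Set (Fin T → Fin k → ℝ)} (hS : MeasurableSet S) :
    ((noiseMeasure T N k ε).prod H.P) {p | M.output x x (H.respond p.2) p.1 ∈ S} ≤
      ENNReal.ofReal (Real.exp ε') *
        ((noiseMeasure T N k ε).prod H.P) {p | M.output x y (H.respond p.2) p.1 ∈ S} := by
  have hmeas : MeasurableSet {v : Noise T N k × (Fin N → AdvMove d) × (Fin N → Fin d → ℝ) |
      M.output x x (answersOf v.2.2) v.1 ∈ S} :=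
    (M.measurable_output x x hg measurable_answersOf).comp
      (measurable_fst.prodMk (measurable_snd.comp measurable_snd)) hS
  have hL := fun p : Noise T N k × H.Coins =>
    M.output_respond_eq hε hg hN hxy hts H .L p.1 p.2
  have hR := fun p : Noise T N k × H.Coins =>
    M.output_respond_eq hε hg hN hxy hts H .R p.1 p.2
  simp only [Side.pick] at hL hR
  simp only [hL, hR]
  exact (hH (M.simulator hε hg hN hxy hts) _ hmeas).1

/-- If no interval may be closed, the output is constant. -/
theorem output_eq_const (x y : ℕ → Fin d → ℕ) (ρ : List (Fin d → ℕ) → Fin d → ℝ)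
    (ν : Noise T 0 k) : M.output x y ρ ν = fun _ i => M.g i 0 := by
  have h : ∀ t, (M.run x y ρ ν t).out = fun i => M.g i 0 := by
    intro t
    induction t with
    | zero => rfl
    | succ t ih =>
      have he : M.event ν t (x t) (M.run x y ρ ν t) = none :=
        M.event_eq_none_iff.2 fun h => Nat.not_lt_zero _ h.2.1
      rw [run, he]
      exact ih
  funext t
  rw [output, h]

end MechParams

/-! ### Composition -/

namespace MechParams

variable {d k T N : ℕ} (M : MechParams d k)

/-- Privacy of the mechanism for arbitrary initial setting. -/
theorem isDifferentiallyPrivate {ε : ℝ} (hε : 0 < ε)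
    (hg : ∀ i, IsMonotoneHistogramQuery (M.g i)) (H : HistogramMechanism.{u} d)
    (hH : H.IsAdaptivelyDP N (ε / 3)) :
    IsDifferentiallyPrivate ((noiseMeasure T N k ε).prod H.P)
      (kQueryMechanism (d := d) (T := T) N M.g H M.s₀ M.K M.C) ε := by
  have := isProbabilityMeasure_noiseMeasure T N k hε
  have hm := fun i => (hg i).measurable
  have hone : 1 ≤ ENNReal.ofReal (Real.exp ε) :=
    ENNReal.one_le_ofReal.2 (Real.one_le_exp hε.le)
  intro x y hn S hS
  by_cases heq : x = y
  · rw [heq]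
    exact le_mul_of_one_le_left' hone
  obtain ⟨ts, hne⟩ := Function.ne_iff.1 heq
  have hxy : ∀ t : ℕ, t ≠ ts → natStream x t = natStream y t := by
    intro t ht
    funext i
    simp only [natStream]
    split_ifs with h
    · have : x ⟨t, h⟩ = y ⟨t, h⟩ := by
        by_contra h'
        exact ht (congrArg Fin.val (hn _ _ h' hne))
      rw [this]
    · rfl
  have hts : ∀ i, |(natStream x ts i : ℤ) - natStream y ts i| ≤ 1 := by
    intro i
    simp only [natStream, ts.isLt, dif_pos, Fin.eta]
    rw [abs_le]
    omega
  simp only [kQueryMechanism_eq_run]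
  change ((noiseMeasure T N k ε).prod H.P)
      {p | M.output (natStream x) (natStream x) (H.respond p.2) p.1 ∈ S} ≤
    _ * ((noiseMeasure T N k ε).prod H.P)
      {p | M.output (natStream y) (natStream y) (H.respond p.2) p.1 ∈ S}
  rcases Nat.eq_zero_or_pos N with rfl | hN
  · simp only [output_eq_const]
    exact le_mul_of_one_le_left' hone
  have h₁ := M.prod_output_mem_le hε hm hN hxy hts H hH hS
  have hmeas : ∀ z, MeasurableSet {p : Noise T N k × H.Coins |
      M.output z (natStream y) (H.respond p.2) p.1 ∈ S} := fun z =>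
    M.measurable_output z _ hm H.measurable_respond hS
  have h₂ : ((noiseMeasure T N k ε).prod H.P)
        {p | M.output (natStream x) (natStream y) (H.respond p.2) p.1 ∈ S} ≤
      ENNReal.ofReal (Real.exp (2 * ε / 3)) * ((noiseMeasure T N k ε).prod H.P)
        {p | M.output (natStream y) (natStream y) (H.respond p.2) p.1 ∈ S} := by
    rw [Measure.prod_apply_symm (hmeas _), Measure.prod_apply_symm (hmeas _),
      ← lintegral_const_mul' _ _ ENNReal.ofReal_ne_top]
    exact lintegral_mono fun ω => M.noiseMeasure_output_mem_le (H.respond ω) hε hg hxy hts S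
  calc _ ≤ _ := h₁
    _ ≤ _ := mul_le_mul_right h₂ _
    _ = _ := by
      rw [← mul_assoc, ← ENNReal.ofReal_mul (Real.exp_pos _).le, ← Real.exp_add]
      ring_nf

end MechParams

theorem mainTheorem5 {d k T cmax : ℕ} (ε : ℝ) (hε : 0 < ε)
    (g : Fin k → (Fin d → ℝ) → ℝ) (hg : ∀ i, IsMonotoneHistogramQuery (g i))
    (H : HistogramMechanism d) (hH : H.IsAdaptivelyDP (k * cmax) (ε / 3)) :
    -- the mechanism with its own parameters
    (∀ (β : ℝ) (err : ℕ → ℝ), 0 < β → β < 1 →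
      IsDifferentiallyPrivate ((noiseMeasure T (k * cmax) k ε).prod H.P)
        (kQueryMechanism (d := d) (T := T) (k * cmax) g H 0
          (threshParam k T cmax ε β err) (slackParam k T cmax ε β)) ε) ∧
    -- independence of the initial setting of `s`, `K` and `C`
    (∀ (s₀ : Fin d → ℝ) (K C : ℝ),
      IsDifferentiallyPrivate ((noiseMeasure T (k * cmax) k ε).prod H.P)
        (kQueryMechanism (d := d) (T := T) (k * cmax) g H s₀ K C) ε) := by
  have h : ∀ (s₀ : Fin d → ℝ) (K C : ℝ),
      IsDifferentiallyPrivate ((noiseMeasure T (k * cmax) k ε).prod H.P)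
        (kQueryMechanism (d := d) (T := T) (k * cmax) g H s₀ K C) ε :=
    fun s₀ K C => MechParams.isDifferentiallyPrivate ⟨g, s₀, K, C⟩ hε hg H hH
  exact ⟨fun _ _ _ _ => h _ _ _, h⟩
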